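/- Let $F$ be a field of characteristic $p \ge 0$ and let $n$ be a positive integer with $p \nmid n$. An ordered factorization of $n$ is a finite sequence $\mathbf d = (d_1,\dots,d_\ell)$ of integers $d_i \ge 2$ with $d_1\cdots d_\ell = n$. Let $\mathcal P_n$ be the set of monic polynomials $f \in F[x]$ of degree $n$ with $f(0)=0$. A polynomial $f$ has decomposition degree sequence $\mathbf d$ if $f = g_1\circ\cdots\circ g_\ell$ for some $g_i \in F[x]$ with $\deg g_i = d_i$ for all $i$ (the empty composition being $x$). For a set $\mathbf D$ of ordered factorizations of $n$ let $$\mathcal D_{n,\mathbf D} = \{ f\in\mathcal P_n : f \text{ has decomposition degree sequence } \mathbf d \text{ for every } \mathbf d\in\mathbf D\}.$$ Two ordered factorizations $\mathbf d=(d_1,\dots,d_\ell)$ and $\mathbf e=(e_1,\dots,e_\ell)$ of $n$ with the same multiset of entries are associated if the unique permutation $\sigma$ with $d_i = e_{\sigma(i)}$ for all $i$ and $\sigma(i)<\sigma(j)$ for all $i<j$ with $d_i=d_j$ also satisfies $\sigma(i)<\sigma(j)$ for all $i<j$ with $\gcd(d_i,d_j)>1$. A nonempty set $\mathbf D$ of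 ordered factorizations of $n$ is normalized if its elements are pairwise associated; its basis is then the common multiset of entries of its elements. The relation graph $G$ of a normalized set $\mathbf D$ is the directed graph whose vertices are the elements of the basis of $\mathbf D$, repeated elements being distinguished (the $k$-th copy of $a$ is identified with the $k$-th occurrence of $a$ in each $\mathbf d\in\mathbf D$), with an edge $u \leftarrow v$ whenever $u$ appears before $v$ in some $\mathbf d\in\mathbf D$. A Hamiltonian path $e_1\leftarrow\cdots\leftarrow e_\ell$ in $G$ (visiting each vertex exactly once) is transitive if $e_i\leftarrow e_j$ is an edge of $G$ for all $i<j$. Let $$\mathcal D_G = \{ f\in\mathcal P_n : f \text{ has decomposition degree sequence } (e_1,\dots,e_\ell) \text{ for every transitive Hamiltonian path } e_1\leftarrow\cdots\leftarrow e_\ell \text{ in } G\}.$$ **Proposition 3.13.** Let $\mathbf D$ be a nonempty normalized set of ordered factorizations of $n$ and $G$ its relation graph. Then $\mathcal D_{n,\mathbf D} = \mathcal D_G$. -/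

import Mathlib

open Polynomial

namespace TameDecomp

/-- `d` is an ordered factorization of `n`: a finite sequence of integers `≥ 2` with product `n`.
The one-term sequence `(n)` is allowed (for `n ≥ 2`); the only ordered factorization of `1` is
the empty one. -/
def IsOrderedFactorization (n : ℕ) (d : List ℕ) : Prop :=
  (∀ a ∈ d, 2 ≤ a) ∧ d.prod = n

/-- `P_n(F)`: the monic original polynomials (`f(0) = 0`) of degree `n`. -/
def monicOriginal (F : Type*) [Field F] (n : ℕ) : Set F[X] :=
  {f | f.Monic ∧ f.eval 0 = 0 ∧ f.natDegree = n}

/-- The composition `g₁ ∘ g₂ ∘ ⋯ ∘ g_ℓ`; the empty composition is `x`. -/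
noncomputable def compList {F : Type*} [Field F] (gs : List F[X]) : F[X] :=
  gs.foldr Polynomial.comp X

/-- `f` has a decomposition `f = g₁ ∘ ⋯ ∘ g_ℓ` with degree sequence `d = (deg g₁, …, deg g_ℓ)`. -/
def HasDegreeSequence {F : Type*} [Field F] (f : F[X]) (d : List ℕ) : Prop :=
  ∃ gs : List F[X], gs.map Polynomial.natDegree = d ∧ f = compList gs

/-- `D_{n,D}`: the monic original polynomials of degree `n` having decompositions with every
degree sequence in `D`. -/
def collisions (F : Type*) [Field F] (n : ℕ) (D : Finset (List ℕ)) : Set F[X] :=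
  {f | f ∈ monicOriginal F n ∧ ∀ d ∈ D, HasDegreeSequence f d}

/-- `d` and `e` are associated: they have the same entries with the same multiplicities, and the
permutation `σ` with `d_i = e_{σ(i)}` that preserves the order of repeated entries also preserves
the order of every two entries that are not coprime. -/
def AreAssociated (d e : List ℕ) : Prop :=
  ∃ σ : Fin d.length ≃ Fin e.length,
    (∀ i, d.get i = e.get (σ i)) ∧
    (∀ i j, i < j → d.get i = d.get j → σ i < σ j) ∧
    (∀ i j, i < j → 1 < Nat.gcd (d.get i) (d.get j) → σ i < σ j)

/-- `D` is a normalized set of ordered factorizations of `n`: its elements are ordered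
factorizations of `n` that are pairwise associated. -/
def IsNormalized (n : ℕ) (D : Finset (List ℕ)) : Prop :=
  (∀ d ∈ D, IsOrderedFactorization n d) ∧ ∀ d ∈ D, ∀ e ∈ D, AreAssociated d e

/-- The basis of `D`. The elements of a normalized set all have the same underlying multiset of
entries, and this is that multiset (see `basis_eq`); in general it is the smallest multiset that
contains the entries of each element of `D` with their multiplicities. -/
def basis (D : Finset (List ℕ)) : Multiset ℕ :=
  D.sup (fun d => (d : Multiset ℕ))

theorem AreAssociated.coe_eq {d e : List ℕ} (h : AreAssociated d e) :
    (d : Multiset ℕ) = (e : Multiset ℕ) := by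
  obtain ⟨σ, h1, -, -⟩ := h
  have hd : (d : Multiset ℕ) = Finset.univ.val.map d.get := by
    rw [Fin.univ_val_map, List.ofFn_get]
  have he : (e : Multiset ℕ) = Finset.univ.val.map e.get := by
    rw [Fin.univ_val_map, List.ofFn_get]
  have hu : (Finset.univ : Finset (Fin e.length)).val = Finset.univ.val.map σ := by
    rw [← Finset.map_univ_equiv σ]; rfl
  rw [hd, he, hu, Multiset.map_map]
  exact Multiset.map_congr rfl (fun i _ => h1 i)

theorem basis_eq {n : ℕ} {D : Finset (List ℕ)} (hD : IsNormalized n D) {d : List ℕ}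
    (hd : d ∈ D) : basis D = (d : Multiset ℕ) :=
  le_antisymm (Finset.sup_le fun e he => (hD.2 e he d hd).coe_eq.le)
    (Finset.le_sup (f := fun d : List ℕ => (d : Multiset ℕ)) hd)

/-- The elements of a multiset `B`, repeated ones being distinguished: the vertex `⟨a, k⟩` is the
copy number `k` of `a`, where `0 ≤ k < B.count a`. -/
abbrev Vertex (B : Multiset ℕ) : Type := B.ToType

/-- The (zero-based) position `i` of `d` carries the vertex `v = ⟨a, k⟩`, that is, `d_i = a` and
exactly `k` of the earlier entries of `d` are equal to `a`. -/
def IsAt {B : Multiset ℕ} (d : List ℕ) (i : ℕ) (v : Vertex B) : Prop :=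
  d[i]? = some v.1 ∧ (d.take i).count v.1 = (v.2 : ℕ)

/-- `v ≺_d w`: the vertex `v` appears before the vertex `w` in `d`. -/
def Precedes {B : Multiset ℕ} (d : List ℕ) (v w : Vertex B) : Prop :=
  ∃ i j : ℕ, i < j ∧ IsAt d i v ∧ IsAt d j w

/-- The relation graph of `D`: its vertices are the elements of the basis of `D`, and there is an
edge `v ← w` (from `w` to `v`) whenever `v ≺_d w` for some `d ∈ D`. -/
def relationGraph (D : Finset (List ℕ)) : Digraph (Vertex (basis D)) where
  Adj w v := ∃ d ∈ D, Precedes d v w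

/-- `e = (e₁, …, e_ℓ)` is a Hamiltonian path `e₁ ← e₂ ← ⋯ ← e_ℓ` in `G`. -/
def IsHamiltonianPath {V : Type*} (G : Digraph V) (e : List V) : Prop :=
  e.IsChain (fun v w => G.Adj w v) ∧ e.Nodup ∧ ∀ v, v ∈ e

/-- The path `e₁ ← ⋯ ← e_ℓ` is transitive in `G`: `e_i ← e_j` is an edge of `G` for all `i < j`. -/
def IsTransitivePath {V : Type*} (G : Digraph V) (e : List V) : Prop :=
  e.Pairwise (fun v w => G.Adj w v)

/-- `D_G` for a digraph `G` on the elements of a multiset `B`: the monic original polynomials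
of degree `n = ∏ B` having, for every transitive Hamiltonian path `e₁ ← ⋯ ← e_ℓ` in `G`, a
decomposition with degree sequence `(e₁, …, e_ℓ)`. -/
def graphCollisions (F : Type*) [Field F] {B : Multiset ℕ} (G : Digraph (Vertex B)) :
    Set F[X] :=
  {f | f ∈ monicOriginal F B.prod ∧
    ∀ e : List (Vertex B), IsHamiltonianPath G e → IsTransitivePath G e →
      HasDegreeSequence f (e.map fun v => v.1)}

end TameDecomp

/-!
Call `m` a right degree of `f` if `f = g ∘ h` with `deg h = m`. The proof has an algebraic and a
combinatorial half, which meet in one statement: the right degrees of a tame polynomial `f`, that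
is, one whose degree is nonzero in `F`, are closed under `gcd` and `lcm`.

*Algebra.* Approximate roots give the closure under `lcm`: a monic `f` of degree `t * s` with `t`
invertible has a unique monic `u` of degree `s` such that `u ^ t` agrees with `f` in its `s`
coefficients below the leading one, and for `f = g ∘ h` the root of `f` is the root of `g` composed
with `h`. So if `f = g₁ ∘ h₁ = g₂ ∘ h₂`, the approximate root `w` of `f` of degree
`lcm (deg h₁) (deg h₂)` lies in `F[h₁] ∩ F[h₂]`. All degrees in this algebra are multiples of
`deg w`, hence it is `F[w]`, and it contains `f` (`exists_right_component_lcm`).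
For the `gcd`, call it `e`, one may replace `f` by `w`. Then all degrees in `F[h₁, h₂]`
are multiples of `e`, and the minimal polynomial of `x` over `F(h₁, h₂)` has degree at most `e` and
coefficients in `F[x]`; comparing degrees modulo `e` in the resulting equation for `x` shows that
its constant term is a common right component of degree `e` (`exists_right_component_gcd`).
Finally, `f` has the degree sequence `d` if and only if the product of every suffix of `d` is a
right degree of `f` (`HasDegreeSequence.prod_mem`, `hasDegreeSequence_of_prod_mem`).

*Combinatorics.* A suffix of some `d ∈ D` is a set of vertices. As the elements of `D` are
associated, it is closed under passing to later vertices with a common factor. For two such closed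
sets `S`, `T` the products of `S \ T` and `T \ S` are coprime, so that the products over `S ∩ T` and
`S ∪ T` are the `gcd` and the `lcm` of those over `S` and `T`. In a transitive Hamiltonian path `e`
any two vertices `u`, `v` in this order are in the same order in some `d ∈ D`, so that a suffix of
`d` contains `v` and not `u`. Hence every suffix of `e` is obtained by unions and intersections from
suffixes of elements of `D` (`prod_mem_of_separated`), and if `f` has all degree sequences in `D`,
it has the degree sequence `e`. Conversely, each `d ∈ D` is itself a transitive Hamiltonian path
(`exists_transitive_path`).
-/

open Polynomial

namespace TameDecomp

section Components

variable {F : Type*} [Field F]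

/-! ### Approximate roots -/

/-- `u` is an approximate `t`-th root of `f`: it is monic and `u ^ t` agrees with `f` in all degrees
from `(t - 1) * deg u` on. When `deg f = t * deg u` these are the `deg u` coefficients below the
leading one, as many as `u` has free coefficients. -/
structure IsApproxRoot (t : ℕ) (f u : F[X]) : Prop where
  monic : u.Monic
  degree_lt : (f - u ^ t).degree < (((t - 1) * u.natDegree : ℕ) : WithBot ℕ)

theorem natDegree_geom_sum₂_le {u v : F[X]} {s : ℕ} (hus : u.natDegree = s)
    (hvs : v.natDegree = s) (t : ℕ) :
    (∑ i ∈ Finset.range t, u ^ i * v ^ (t - 1 - i)).natDegree ≤ (t - 1) * s := by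
  refine natDegree_sum_le_of_forall_le _ _ fun i hi => ?_
  have hi' := Finset.mem_range.1 hi
  refine natDegree_mul_le.trans ?_
  refine (add_le_add natDegree_pow_le natDegree_pow_le).trans ?_
  rw [hus, hvs, ← add_mul, show i + (t - 1 - i) = t - 1 by omega]

theorem coeff_geom_sum₂ {u v : F[X]} {s : ℕ} (hu : u.Monic) (hv : v.Monic)
    (hus : u.natDegree = s) (hvs : v.natDegree = s) (t : ℕ) :
    (∑ i ∈ Finset.range t, u ^ i * v ^ (t - 1 - i)).coeff ((t - 1) * s) = t := by
  rw [finsetSum_coeff, Finset.sum_congr rfl (g := fun _ => (1 : F)), Finset.sum_const,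
    Finset.card_range, nsmul_one]
  intro i hi
  have hi' := Finset.mem_range.1 hi
  have hm : (u ^ i * v ^ (t - 1 - i)).Monic := (hu.pow _).mul (hv.pow _)
  have hd : (u ^ i * v ^ (t - 1 - i)).natDegree = (t - 1) * s := by
    rw [(hu.pow _).natDegree_mul (hv.pow _), hu.natDegree_pow, hv.natDegree_pow, hus, hvs,
      ← add_mul, show i + (t - 1 - i) = t - 1 by omega]
  rw [← hd]
  exact hm.coeff_natDegree

/-- Approximate roots of a given degree are unique: `u ^ t - v ^ t` is `u - v` times a polynomial
with leading term `t * X ^ ((t - 1) * deg u)`. -/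
theorem IsApproxRoot.unique {t : ℕ} {f u v : F[X]} (ht : (t : F) ≠ 0) (hu : IsApproxRoot t f u)
    (hv : IsApproxRoot t f v) (huv : u.natDegree = v.natDegree) : u = v := by
  by_contra hne
  set S := ∑ i ∈ Finset.range t, u ^ i * v ^ (t - 1 - i) with hS
  have hSc : S.coeff ((t - 1) * v.natDegree) = t := coeff_geom_sum₂ hu.1 hv.1 huv rfl t
  have hfac : (f - v ^ t) - (f - u ^ t) = S * (u - v) := by
    rw [hS, geom_sum₂_mul]; ring
  have hlt : (S * (u - v)).degree < (((t - 1) * v.natDegree : ℕ) : WithBot ℕ) := by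
    rw [← hfac]
    refine (degree_sub_le _ _).trans_lt (max_lt hv.2 ?_)
    rw [← huv]; exact hu.2
  have hle : (((t - 1) * v.natDegree : ℕ) : WithBot ℕ) ≤ S.degree :=
    le_degree_of_ne_zero (by rw [hSc]; exact ht)
  have hge : S.degree ≤ (S * (u - v)).degree :=
    degree_le_mul_left _ (sub_ne_zero.2 hne)
  exact absurd (hle.trans hge) (not_le.2 hlt)

/-- Existence of approximate roots, by adjusting the coefficients of `u` one at a time from the top:
adding `c * X ^ j` to `u` changes `u ^ t` by `t * c * X ^ ((t - 1) * deg u + j)` and lower terms. -/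
theorem exists_isApproxRoot {t s : ℕ} {f : F[X]} (ht : (t : F) ≠ 0) (hf : f.Monic)
    (hd : f.natDegree = t * s) : ∃ u : F[X], u.natDegree = s ∧ IsApproxRoot t f u := by
  have ht0 : 0 < t := Nat.pos_of_ne_zero (by rintro rfl; simp at ht)
  have hts : t * s = (t - 1) * s + s := by
    obtain ⟨r, rfl⟩ : ∃ r, t = r + 1 := ⟨t - 1, by omega⟩
    simp [add_mul]
  have key : ∀ k ≤ s, ∃ u : F[X], u.Monic ∧ u.natDegree = s ∧
      (f - u ^ t).degree < (((t - 1) * s + (s - k) : ℕ) : WithBot ℕ) := by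
    intro k
    induction k with
    | zero =>
      intro _
      refine ⟨X ^ s, monic_X_pow s, natDegree_X_pow s, ?_⟩
      have hX : ((X : F[X]) ^ s) ^ t = X ^ (t * s) := by rw [← pow_mul, mul_comm]
      rw [Nat.sub_zero, ← hts, hX, ← hd, ← degree_eq_natDegree hf.ne_zero]
      refine degree_sub_lt_left ?_ hf.ne_zero ?_
      · rw [degree_X_pow, degree_eq_natDegree hf.ne_zero]
      · rw [hf.leadingCoeff, leadingCoeff_X_pow]
    | succ k ih =>
      intro hk
      obtain ⟨u, hu, hus, hlt⟩ := ih (by omega)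
      set c := (f - u ^ t).coeff ((t - 1) * s + (s - (k + 1))) with hc
      set w : F[X] := u + C (c / t) * X ^ (s - (k + 1)) with hw
      have hsm : (C (c / t) * X ^ (s - (k + 1)) : F[X]).degree < u.degree := by
        rw [degree_eq_natDegree hu.ne_zero, hus]
        refine (degree_C_mul_X_pow_le _ _).trans_lt ?_
        exact_mod_cast (by omega : s - (k + 1) < s)
      have hwm : w.Monic := hu.add_of_left hsm
      have hws : w.natDegree = s := by rw [hw, natDegree_add_eq_left_of_degree_lt hsm, hus]
      refine ⟨w, hwm, hws, ?_⟩
      set S := ∑ i ∈ Finset.range t, w ^ i * u ^ (t - 1 - i) with hS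
      have hfac : f - w ^ t = (f - u ^ t) - C (c / t) * (S * X ^ (s - (k + 1))) := by
        have h2 : S * (w - u) = w ^ t - u ^ t := by rw [hS, geom_sum₂_mul]
        have h3 : w - u = C (c / t) * X ^ (s - (k + 1)) := by rw [hw]; ring
        rw [h3] at h2
        linear_combination h2
      have hSd : S.natDegree ≤ (t - 1) * s := natDegree_geom_sum₂_le hws hus t
      have hSc : S.coeff ((t - 1) * s) = t := coeff_geom_sum₂ hwm hu hws hus t
      rw [degree_lt_iff_coeff_zero] at hlt ⊢
      intro m hm
      rw [hfac, coeff_sub, coeff_C_mul]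
      rcases hm.eq_or_lt with rfl | hm
      · rw [coeff_mul_X_pow, hSc, ← hc, div_mul_cancel₀ _ ht, sub_self]
      · rw [hlt m (by omega), coeff_eq_zero_of_natDegree_lt, mul_zero, sub_zero]
        refine natDegree_mul_le.trans_lt ?_
        rw [natDegree_X_pow]
        omega
  obtain ⟨u, hu, hus, hlt⟩ := key s le_rfl
  refine ⟨u, hus, hu, ?_⟩
  rw [hus]
  simpa using hlt

theorem IsApproxRoot.comp {t : ℕ} {g h u : F[X]} (hu : IsApproxRoot t g u) (hh : h.Monic)
    (hh0 : h.natDegree ≠ 0) : IsApproxRoot t (g.comp h) (u.comp h) := by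
  refine ⟨hu.1.comp hh hh0, ?_⟩
  have hcomp : g.comp h - (u.comp h) ^ t = (g - u ^ t).comp h := by simp
  rw [hcomp]
  by_cases h0 : g - u ^ t = 0
  · rw [h0, zero_comp, degree_zero]; exact WithBot.bot_lt_coe _
  · have hlt := hu.2
    rw [degree_eq_natDegree h0, Nat.cast_lt] at hlt
    refine degree_le_natDegree.trans_lt ?_
    rw [natDegree_comp, natDegree_comp, ← mul_assoc]
    exact_mod_cast Nat.mul_lt_mul_of_pos_right hlt (Nat.pos_of_ne_zero hh0)

/-! ### Right components of tame polynomials -/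

/-- If all degrees in a subalgebra of `F[x]` are multiples of `deg h`, where `h` is a nonconstant
element of it, then the subalgebra is `F[h]`. -/
theorem exists_eq_comp_of_natDegree_dvd (A : Subalgebra F F[X]) {h : F[X]} (hA : h ∈ A)
    (hh : h.natDegree ≠ 0) (hdvd : ∀ c ∈ A, h.natDegree ∣ c.natDegree) {c : F[X]} (hc : c ∈ A) :
    ∃ u : F[X], c = u.comp h := by
  induction hn : c.natDegree using Nat.strong_induction_on generalizing c with
  | _ n ih =>
  obtain ⟨k, hk⟩ := hdvd c hc
  by_cases h0 : c.natDegree = 0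
  · exact ⟨C (c.coeff 0), by rw [C_comp]; exact eq_C_of_natDegree_eq_zero h0⟩
  have hne : h ≠ 0 := by rintro rfl; simp at hh
  have hcne : c ≠ 0 := by rintro rfl; simp at h0
  set a := c.leadingCoeff / (h ^ k).leadingCoeff with ha
  have hlk : (h ^ k).leadingCoeff ≠ 0 := leadingCoeff_ne_zero.2 (pow_ne_zero _ hne)
  have ha0 : a ≠ 0 := div_ne_zero (leadingCoeff_ne_zero.2 hcne) hlk
  have hdeg : (C a * h ^ k).natDegree = c.natDegree := by
    rw [natDegree_C_mul ha0, natDegree_pow, hk, mul_comm]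
  have hlt : (c - C a * h ^ k).natDegree < n := by
    rw [← hn]
    have hdl : (c - C a * h ^ k).degree < c.degree := by
      refine degree_sub_lt_left ?_ hcne ?_
      · rw [degree_eq_natDegree hcne, ← hdeg, degree_eq_natDegree
          (mul_ne_zero (C_ne_zero.2 ha0) (pow_ne_zero _ hne))]
      · rw [leadingCoeff_mul, leadingCoeff_C, ha, div_mul_cancel₀ _ hlk]
    rcases eq_or_ne (c - C a * h ^ k) 0 with h1 | h1
    · rw [h1, natDegree_zero]; omega
    · exact natDegree_lt_natDegree h1 hdl
  obtain ⟨u, hu⟩ := ih _ hlt (A.sub_mem hc (by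
    rw [← smul_eq_C_mul]; exact A.smul_mem (A.pow_mem hA k) a)) rfl
  refine ⟨u + C a * X ^ k, ?_⟩
  simp [← hu]

theorem mem_adjoin_singleton_iff_comp {h c : F[X]} :
    c ∈ Algebra.adjoin F {h} ↔ ∃ u : F[X], c = u.comp h := by
  rw [Algebra.adjoin_singleton_eq_range_aeval]
  simp only [AlgHom.mem_range, comp_eq_aeval, eq_comm]

/-- Degrees of right components of a tame polynomial are closed under `lcm`. The common
approximate root `w` of `f` of degree `lcm` lies in `F[h₁] ∩ F[h₂]`, by uniqueness of approximate
roots, and hence generates this algebra. -/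
theorem exists_right_component_lcm {f g₁ g₂ h₁ h₂ : F[X]} (hf : f.Monic)
    (hn : (f.natDegree : F) ≠ 0) (hm₁ : h₁.Monic) (hm₂ : h₂.Monic) (hf₁ : f = g₁.comp h₁)
    (hf₂ : f = g₂.comp h₂) :
    ∃ w g u₁ u₂ : F[X], w.Monic ∧ w.natDegree = Nat.lcm h₁.natDegree h₂.natDegree ∧
      f = g.comp w ∧ w = u₁.comp h₁ ∧ w = u₂.comp h₂ := by
  have hn0 : f.natDegree ≠ 0 := fun h => hn (by rw [h, Nat.cast_zero])
  have hd₁ : f.natDegree = g₁.natDegree * h₁.natDegree := by rw [hf₁, natDegree_comp]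
  have hd₂ : f.natDegree = g₂.natDegree * h₂.natDegree := by rw [hf₂, natDegree_comp]
  have hh₁ : h₁.natDegree ≠ 0 := fun h => hn0 (by rw [hd₁, h, mul_zero])
  have hh₂ : h₂.natDegree ≠ 0 := fun h => hn0 (by rw [hd₂, h, mul_zero])
  obtain ⟨t, ht⟩ : Nat.lcm h₁.natDegree h₂.natDegree ∣ f.natDegree :=
    Nat.lcm_dvd ⟨_, by rw [hd₁, mul_comm]⟩ ⟨_, by rw [hd₂, mul_comm]⟩
  have htF : (t : F) ≠ 0 := fun h => hn (by rw [ht, Nat.cast_mul, h, mul_zero])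
  -- the approximate `t`-th root of `f` is the one of `g`, composed with `h`
  have root : ∀ {g h : F[X]}, h.Monic → h.natDegree ≠ 0 → f = g.comp h →
      h.natDegree ∣ Nat.lcm h₁.natDegree h₂.natDegree →
      ∃ u : F[X], (u.comp h).natDegree = Nat.lcm h₁.natDegree h₂.natDegree ∧
        IsApproxRoot t f (u.comp h) := by
    rintro g h hm h0 rfl ⟨s, hs⟩
    have hg : g.Monic := by
      have := hf.leadingCoeff
      rw [leadingCoeff_comp h0, hm.leadingCoeff, one_pow, mul_one] at this
      exact this
    have hgd : g.natDegree = t * s := by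
      rw [natDegree_comp, hs] at ht
      refine Nat.eq_of_mul_eq_mul_right (Nat.pos_of_ne_zero h0) (ht.trans (by ring))
    obtain ⟨u, hus, hu⟩ := exists_isApproxRoot htF hg hgd
    exact ⟨u, by rw [natDegree_comp, hus, hs, mul_comm], hu.comp hm h0⟩
  obtain ⟨u₁, hu₁d, hu₁⟩ := root hm₁ hh₁ hf₁ (Nat.dvd_lcm_left _ _)
  obtain ⟨u₂, hu₂d, hu₂⟩ := root hm₂ hh₂ hf₂ (Nat.dvd_lcm_right _ _)
  have huu : u₁.comp h₁ = u₂.comp h₂ := hu₁.unique htF hu₂ (hu₁d.trans hu₂d.symm)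
  have hgen : ∃ g : F[X], f = g.comp (u₁.comp h₁) := by
    refine exists_eq_comp_of_natDegree_dvd (Algebra.adjoin F {h₁} ⊓ Algebra.adjoin F {h₂})
      ⟨mem_adjoin_singleton_iff_comp.2 ⟨_, rfl⟩, mem_adjoin_singleton_iff_comp.2 ⟨_, huu⟩⟩
      (by rw [hu₁d]; exact Nat.lcm_ne_zero hh₁ hh₂) ?_
      ⟨mem_adjoin_singleton_iff_comp.2 ⟨_, hf₁⟩, mem_adjoin_singleton_iff_comp.2 ⟨_, hf₂⟩⟩
    rintro c ⟨hc₁, hc₂⟩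
    obtain ⟨v₁, hv₁⟩ := mem_adjoin_singleton_iff_comp.1 hc₁
    obtain ⟨v₂, hv₂⟩ := mem_adjoin_singleton_iff_comp.1 hc₂
    rw [hu₁d]
    exact Nat.lcm_dvd ⟨v₁.natDegree, by rw [hv₁, natDegree_comp, mul_comm]⟩
      ⟨v₂.natDegree, by rw [hv₂, natDegree_comp, mul_comm]⟩
  obtain ⟨g, hg⟩ := hgen
  exact ⟨_, g, u₁, u₂, hu₁.monic, hu₁d, hg, rfl, huu⟩

/-! ### Greatest common right components -/

/-- Reduction in `F[h₁][T]` modulo `u₂(T) - u₁(h₁)`, a monic polynomial with root `h₂`. -/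
theorem exists_eq_sum_of_mem_adjoin {u₁ u₂ h₁ h₂ : F[X]} (hu₂ : u₂.Monic)
    (hu₂0 : u₂.natDegree ≠ 0) (he : u₁.comp h₁ = u₂.comp h₂) {c : F[X]}
    (hc : c ∈ Algebra.adjoin F {h₁, h₂}) :
    ∃ p : ℕ → F[X], c = ∑ j ∈ Finset.range u₂.natDegree, (p j).comp h₁ * h₂ ^ j := by
  let φ : F[X][X] →+* F[X] := eval₂RingHom (compRingHom h₁) h₂
  have hφ : ∃ Q : F[X][X], φ Q = c := by
    induction hc using Algebra.adjoin_induction with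
    | mem x hx =>
      rcases hx with rfl | rfl
      · exact ⟨C X, by simp [φ]⟩
      · exact ⟨X, by simp [φ]⟩
    | algebraMap r => exact ⟨C (C r), by simp [φ, algebraMap_eq]⟩
    | add x y _ _ hx hy =>
      obtain ⟨a, rfl⟩ := hx
      obtain ⟨b, rfl⟩ := hy
      exact ⟨a + b, map_add _ _ _⟩
    | mul x y _ _ hx hy =>
      obtain ⟨a, rfl⟩ := hx
      obtain ⟨b, rfl⟩ := hy
      exact ⟨a * b, map_mul _ _ _⟩
  obtain ⟨Q, hQ⟩ := hφ
  have hlt : (C u₁ : F[X][X]).degree < (u₂.map C).degree := by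
    rw [degree_map_eq_of_injective C_injective]
    exact degree_C_le.trans_lt (natDegree_pos_iff_degree_pos.1 (Nat.pos_of_ne_zero hu₂0))
  have hM : (u₂.map C - C u₁ : F[X][X]).Monic := (hu₂.map C).sub_of_left hlt
  have hMd : (u₂.map C - C u₁ : F[X][X]).natDegree = u₂.natDegree := by
    rw [natDegree_sub_eq_left_of_natDegree_lt, natDegree_map]
    rw [natDegree_map, natDegree_C]; exact Nat.pos_of_ne_zero hu₂0
  have hφM : φ (u₂.map C - C u₁) = 0 := by
    have h1 : φ (u₂.map C) = u₂.comp h₂ := by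
      simp only [φ, coe_eval₂RingHom, eval₂_map, comp]
      congr 1
      ext; simp
    have h2 : φ (C u₁) = u₁.comp h₁ := by simp [φ]
    rw [map_sub, h1, h2, he, sub_self]
  have hφr : φ (Q %ₘ (u₂.map C - C u₁)) = c := by
    rw [← hQ]
    conv_rhs => rw [← modByMonic_add_div Q (u₂.map C - C u₁)]
    rw [map_add, map_mul, hφM, zero_mul, add_zero]
  refine ⟨(Q %ₘ (u₂.map C - C u₁)).coeff, ?_⟩
  conv_lhs => rw [← hφr]
  have hr : (Q %ₘ (u₂.map C - C u₁)).natDegree < u₂.natDegree := by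
    have := natDegree_modByMonic_lt Q hM (fun h => hu₂0 (by rw [← hMd, h, natDegree_one]))
    rwa [hMd] at this
  simp only [φ, coe_eval₂RingHom]
  rw [eval₂_eq_sum_range' _ hr]
  rfl

/-- If `h₁`, `h₂` have a common left multiple `u₁ ∘ h₁ = u₂ ∘ h₂` of degree
`lcm (deg h₁) (deg h₂)`, then all degrees in `F[h₁, h₂]` are multiples of `gcd (deg h₁) (deg h₂)`.
By the Chinese remainder theorem the terms `pⱼ(h₁) * h₂ ^ j` with `j < deg u₂` have distinct
degrees, so nothing cancels. -/
theorem gcd_dvd_natDegree_of_mem_adjoin {u₁ u₂ h₁ h₂ : F[X]} (hu₂ : u₂.Monic)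
    (he : u₁.comp h₁ = u₂.comp h₂) (hh₂ : h₂.natDegree ≠ 0) (hh₁ : h₁.natDegree ≠ 0)
    (hl : (u₂.comp h₂).natDegree = Nat.lcm h₁.natDegree h₂.natDegree) {c : F[X]}
    (hc : c ∈ Algebra.adjoin F {h₁, h₂}) : Nat.gcd h₁.natDegree h₂.natDegree ∣ c.natDegree := by
  obtain ⟨t, s, hts, ha, hb⟩ := Nat.exists_coprime h₁.natDegree h₂.natDegree
  set e := Nat.gcd h₁.natDegree h₂.natDegree with he_def
  have he0 : 0 < e := Nat.gcd_pos_of_pos_left _ (Nat.pos_of_ne_zero hh₁)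
  have hu₂d : u₂.natDegree = t := by
    have h1 : e * Nat.lcm h₁.natDegree h₂.natDegree = h₁.natDegree * h₂.natDegree :=
      Nat.gcd_mul_lcm _ _
    rw [← hl, natDegree_comp, ha, mul_comm t e, mul_assoc, ← mul_assoc e] at h1
    have h2 := Nat.eq_of_mul_eq_mul_left he0 (by simpa only [mul_assoc] using h1)
    exact Nat.eq_of_mul_eq_mul_right (Nat.pos_of_ne_zero hh₂) h2
  have hu₂0 : u₂.natDegree ≠ 0 := by
    rw [hu₂d]; rintro rfl; exact hh₁ (by rw [ha, zero_mul])
  obtain ⟨p, rfl⟩ := exists_eq_sum_of_mem_adjoin hu₂ hu₂0 he hc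
  have hne₂ : h₂ ≠ 0 := by rintro rfl; simp at hh₂
  have hdeg : ∀ j, (p j).comp h₁ * h₂ ^ j ≠ 0 →
      ((p j).comp h₁ * h₂ ^ j).natDegree = e * (t * (p j).natDegree + s * j) := by
    intro j hj
    rw [natDegree_mul (left_ne_zero_of_mul hj) (pow_ne_zero _ hne₂), natDegree_comp,
      natDegree_pow, ha, hb]
    ring
  rw [natDegree_sum_eq_of_disjoint]
  · refine Finset.sup_induction (dvd_zero _) (fun a ha b hb => ?_) fun j _ => ?_
    · rcases max_choice a b with h | h
      · rw [h]; exact ha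
      · rw [h]; exact hb
    · by_cases h0 : (p j).comp h₁ * h₂ ^ j = 0
      · rw [h0, natDegree_zero]; exact dvd_zero _
      · rw [hdeg j h0]; exact dvd_mul_right _ _
  · rintro i ⟨hi, hi0⟩ j ⟨hj, hj0⟩ hij heq
    simp only [Function.comp] at heq
    rw [hdeg i hi0, hdeg j hj0] at heq
    have h1 := Nat.eq_of_mul_eq_mul_left he0 heq
    have h2 : s * i ≡ s * j [MOD t] := by
      have : (t * (p i).natDegree + s * i) % t = (t * (p j).natDegree + s * j) % t := by rw [h1]
      simpa [Nat.ModEq, Nat.add_mod] using this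
    have h3 : i ≡ j [MOD t] := Nat.ModEq.cancel_left_of_coprime hts h2
    rw [Finset.mem_range, hu₂d] at hi hj
    exact hij (h3.eq_of_lt_of_lt hi hj)

open IntermediateField in
/-- The minimal polynomial of `x` over a subfield of `F(x)` that contains a nonconstant monic
polynomial `h₁` has coefficients in `F[x]`, by the Gauss lemma, since it divides
`h₁(T) - h₁(x)`. -/
theorem exists_polynomial_minpoly (K : IntermediateField F (RatFunc F)) {h₁ : F[X]}
    (hm : h₁.Monic) (hh : h₁.natDegree ≠ 0) (hK : algebraMap F[X] (RatFunc F) h₁ ∈ K) :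
    ∃ P : F[X][X], P.Monic ∧ P.natDegree = Module.finrank K (RatFunc F) ∧ P.eval X = 0 ∧
      ∀ i, algebraMap F[X] (RatFunc F) (P.coeff i) ∈ K := by
  set ι := algebraMap F[X] (RatFunc F) with hι
  have hinj : Function.Injective ι := RatFunc.algebraMap_injective F
  set Q : K[X] := h₁.map (algebraMap F K) - C ⟨ι h₁, hK⟩ with hQ
  have hlt : (C ⟨ι h₁, hK⟩ : K[X]).degree < (h₁.map (algebraMap F K)).degree := by
    rw [degree_map_eq_of_injective (algebraMap F K).injective]
    exact degree_C_le.trans_lt (natDegree_pos_iff_degree_pos.1 (Nat.pos_of_ne_zero hh))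
  have hQm : Q.Monic := (hm.map _).sub_of_left hlt
  have hQ0 : aeval (RatFunc.X : RatFunc F) Q = 0 := by
    rw [hQ, map_sub, aeval_map_algebraMap, aeval_C, RatFunc.aeval_X_left_eq_algebraMap]
    exact sub_self _
  have hint : IsIntegral K (RatFunc.X : RatFunc F) := ⟨Q, hQm, hQ0⟩
  have hdvd := minpoly.dvd K (RatFunc.X : RatFunc F) hQ0
  set p := minpoly K (RatFunc.X : RatFunc F) with hp
  have hpm : p.Monic := minpoly.monic hint
  have hpd : p.natDegree = Module.finrank K (RatFunc F) := by
    rw [← (RatFunc.IntermediateField.adjoinXEquiv K).toLinearEquiv.finrank_eq,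
      adjoin.finrank hint]
  have hltC : (C h₁ : F[X][X]).degree < (h₁.map C).degree := by
    rw [degree_map_eq_of_injective C_injective]
    exact degree_C_le.trans_lt (natDegree_pos_iff_degree_pos.1 (Nat.pos_of_ne_zero hh))
  have hmap : Q.map (algebraMap K (RatFunc F)) = (h₁.map C - C h₁ : F[X][X]).map ι := by
    rw [hQ, Polynomial.map_sub, Polynomial.map_sub, Polynomial.map_map, Polynomial.map_map,
      map_C, map_C, ← IsScalarTower.algebraMap_eq]
    congr 2
  obtain ⟨P, hP⟩ := IsIntegrallyClosed.eq_map_mul_C_of_dvd (RatFunc F)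
    (show (h₁.map C - C h₁ : F[X][X]).Monic from (hm.map C).sub_of_left hltC)
    (g := p.map (algebraMap K (RatFunc F))) (by
      rw [← hι, ← hmap]
      exact Polynomial.map_dvd _ hdvd)
  rw [(hpm.map _).leadingCoeff, C_1, mul_one, ← hι] at hP
  refine ⟨P, ?_, ?_, ?_, fun i => ?_⟩
  · exact Polynomial.monic_of_injective hinj (by rw [hP]; exact hpm.map _)
  · rw [← hpd, ← natDegree_map_eq_of_injective hinj P, hP, natDegree_map]
  · apply hinj
    have h1 := minpoly.aeval K (RatFunc.X : RatFunc F)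
    rw [← hp, aeval_def, ← eval_map, ← hP] at h1
    rw [map_zero, ← h1, ← RatFunc.algebraMap_X, ← hι, eval_map, eval₂_at_apply]
  · rw [← coeff_map, hP, coeff_map]
    exact (p.coeff i).2

open IntermediateField in
theorem finrank_dvd_natDegree (K : IntermediateField F (RatFunc F)) {h : F[X]}
    (hK : algebraMap F[X] (RatFunc F) h ∈ K) : Module.finrank K (RatFunc F) ∣ h.natDegree := by
  have h1 := finrank_dvd_of_le_left (adjoin_simple_le_iff.2 hK)
  rwa [RatFunc.finrank_eq_max_natDegree, RatFunc.num_algebraMap, RatFunc.denom_algebraMap,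
    natDegree_one, Nat.max_zero] at h1

/-- Two right components `h₁`, `h₂` with a common left multiple of degree
`lcm (deg h₁) (deg h₂)` have a common right component of degree `gcd (deg h₁) (deg h₂) = e`.
Let `K = F(h₁, h₂)`. The minimal polynomial `P` of `x` over `K` has degree at most `e`, and its
coefficients lie in `K ∩ F[x]`, where all degrees are multiples of `e`. So two terms of `P(x) = 0`
can only have the same degree when they are the first and the last and `deg P = e`, and then `P(0)`
has degree `e`. It generates `K ∩ F[x]`. -/
theorem exists_right_component_gcd {w u₁ u₂ h₁ h₂ : F[X]} (hw : w.Monic) (hm₁ : h₁.Monic)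
    (hm₂ : h₂.Monic) (hh₁ : h₁.natDegree ≠ 0) (hh₂ : h₂.natDegree ≠ 0) (hw₁ : w = u₁.comp h₁)
    (hw₂ : w = u₂.comp h₂) (hwd : w.natDegree = Nat.lcm h₁.natDegree h₂.natDegree) :
    ∃ v h : F[X], h₁ = v.comp h ∧ h.natDegree = Nat.gcd h₁.natDegree h₂.natDegree := by
  have hu₂ : u₂.Monic := by
    have := hw.leadingCoeff
    rw [hw₂, leadingCoeff_comp hh₂, hm₂.leadingCoeff, one_pow, mul_one] at this
    exact this
  set e := Nat.gcd h₁.natDegree h₂.natDegree with he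
  have he0 : 0 < e := Nat.gcd_pos_of_pos_left _ (Nat.pos_of_ne_zero hh₁)
  have hW : ∀ c ∈ Algebra.adjoin F {h₁, h₂}, e ∣ c.natDegree := fun c hc =>
    gcd_dvd_natDegree_of_mem_adjoin hu₂ (hw₁.symm.trans hw₂) hh₂ hh₁ (by rw [← hw₂, hwd]) hc
  set ι : F[X] →ₐ[F] RatFunc F := IsScalarTower.toAlgHom F F[X] (RatFunc F) with hι
  have hinj : Function.Injective ι := RatFunc.algebraMap_injective F
  set K : IntermediateField F (RatFunc F) := IntermediateField.adjoin F (ι '' {h₁, h₂}) with hKdef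
  have hK₁ : ι h₁ ∈ K := IntermediateField.subset_adjoin _ _ ⟨h₁, by simp, rfl⟩
  have hK₂ : ι h₂ ∈ K := IntermediateField.subset_adjoin _ _ ⟨h₂, by simp, rfl⟩
  -- elements of `K` are quotients of elements of `F[h₁, h₂]`
  have hKd : ∀ c : F[X], ι c ∈ K → e ∣ c.natDegree := by
    intro c hc
    obtain ⟨r, hr, q, hq, hrq⟩ := IntermediateField.mem_adjoin_iff_div.1 hc
    rw [← AlgHom.map_adjoin] at hr hq
    obtain ⟨r, hr, rfl⟩ := hr
    obtain ⟨q, hq, rfl⟩ := hq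
    by_cases hc0 : c = 0
    · rw [hc0, natDegree_zero]; exact dvd_zero _
    have hq0 : q ≠ 0 := by
      rintro rfl
      apply hc0
      apply hinj
      rw [hrq]
      simp
    have hcq : c * q = r := by
      apply hinj
      rw [map_mul, hrq]
      exact div_mul_cancel₀ _ (fun h => hq0 (hinj (by rw [map_zero]; exact h)))
    have h1 := hW r hr
    rw [← hcq, natDegree_mul hc0 hq0] at h1
    exact (Nat.dvd_add_left (hW q hq)).1 h1
  obtain ⟨P, hPm, hPd, hP0, hPK⟩ := exists_polynomial_minpoly K hm₁ hh₁ hK₁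
  have hPe : P.natDegree ≤ e := by
    refine Nat.le_of_dvd he0 ?_
    rw [hPd]
    exact Nat.dvd_gcd (finrank_dvd_natDegree K hK₁) (finrank_dvd_natDegree K hK₂)
  have hcol : ∃ i ≤ P.natDegree, ∃ j ≤ P.natDegree, i < j ∧
      (P.coeff i).natDegree + i = (P.coeff j).natDegree + j := by
    by_contra hno
    have hterm : ∀ i, P.coeff i * X ^ i ≠ 0 →
        (P.coeff i * X ^ i).natDegree = (P.coeff i).natDegree + i := fun i hi => by
      rw [natDegree_mul (left_ne_zero_of_mul hi) (pow_ne_zero _ X_ne_zero), natDegree_X_pow]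
    have hsum := degree_sum_eq_of_disjoint (fun i => P.coeff i * X ^ i)
      (Finset.range (P.natDegree + 1)) (by
        rintro i ⟨hi, hi0⟩ j ⟨hj, hj0⟩ hij heq
        simp only [Function.comp] at heq
        have h1 := natDegree_eq_of_degree_eq heq
        rw [hterm i hi0, hterm j hj0] at h1
        rw [Finset.mem_range, Nat.lt_succ_iff] at hi hj
        rcases lt_or_gt_of_ne hij with h | h
        · exact hno ⟨i, hi, j, hj, h, h1⟩
        · exact hno ⟨j, hj, i, hi, h, h1.symm⟩)
    rw [← eval_eq_sum_range, hP0, degree_zero, eq_comm, Finset.sup_eq_bot_iff] at hsum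
    have h1 := hsum P.natDegree (Finset.self_mem_range_succ _)
    rw [hPm.coeff_natDegree, one_mul, degree_X_pow] at h1
    exact absurd h1 (WithBot.coe_ne_bot)
  obtain ⟨i, hi, j, hj, hij, hdeg⟩ := hcol
  obtain ⟨ki, hki⟩ := hKd _ (hPK i)
  obtain ⟨kj, hkj⟩ := hKd _ (hPK j)
  have hje : j - i = e := by
    have h1 : e ∣ j - i := by
      refine (Nat.dvd_add_right (dvd_mul_right e kj)).1 ⟨ki, ?_⟩
      omega
    have h2 := Nat.le_of_dvd (by omega) h1
    omega
  have hi0 : i = 0 := by omega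
  have hjP : j = P.natDegree := by omega
  have hh : (P.coeff 0).natDegree = e := by
    rw [hi0, hjP, hPm.coeff_natDegree, natDegree_one] at hdeg
    omega
  obtain ⟨v, hv⟩ := exists_eq_comp_of_natDegree_dvd (K.toSubalgebra.comap ι) (h := P.coeff 0)
    (hPK 0) (by omega) (fun c hc => by rw [hh]; exact hKd c hc) (c := h₁) hK₁
  exact ⟨v, P.coeff 0, hv, hh⟩

/-! ### Degrees of right components and degree sequences -/

/-- The degrees of the right components of `f`, that is, of the `h` with `f = g ∘ h`. -/
def rightDegrees (f : F[X]) : Set ℕ :=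
  {m | ∃ g h : F[X], f = g.comp h ∧ h.natDegree = m}

/-- A nonconstant right component can be made monic and original by a linear left factor. -/
theorem exists_monic_original_right {f g h : F[X]} (hf : f = g.comp h) (hh : h.natDegree ≠ 0) :
    ∃ g' h' : F[X], f = g'.comp h' ∧ h'.Monic ∧ h'.eval 0 = 0 ∧ h'.natDegree = h.natDegree := by
  have hne : h ≠ 0 := by rintro rfl; simp at hh
  have hl : h.leadingCoeff ≠ 0 := leadingCoeff_ne_zero.2 hne
  have hd : (h - C (h.eval 0)).natDegree = h.natDegree := natDegree_sub_C
  have hlc : (h - C (h.eval 0)).leadingCoeff = h.leadingCoeff := by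
    rw [leadingCoeff, hd, coeff_sub, coeff_C_of_ne_zero hh, sub_zero, leadingCoeff]
  refine ⟨g.comp (C h.leadingCoeff * X + C (h.eval 0)),
    C h.leadingCoeff⁻¹ * (h - C (h.eval 0)), ?_, ?_, ?_, ?_⟩
  · rw [comp_assoc, hf]
    congr 1
    simp only [add_comp, mul_comp, C_comp, X_comp]
    rw [← mul_assoc, ← C_mul, mul_inv_cancel₀ hl, C_1, one_mul, sub_add_cancel]
  · rw [Monic, leadingCoeff_mul, leadingCoeff_C, hlc, inv_mul_cancel₀ hl]
  · simp
  · rw [natDegree_C_mul (inv_ne_zero hl), hd]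

theorem ne_zero_of_mem_rightDegrees {f : F[X]} (hn : f.natDegree ≠ 0) {a : ℕ}
    (ha : a ∈ rightDegrees f) : a ≠ 0 := by
  obtain ⟨g, h, rfl, rfl⟩ := ha
  intro h0
  rw [natDegree_comp, h0, mul_zero] at hn
  exact hn rfl

theorem exists_monic_right_of_mem {f : F[X]} (hn : f.natDegree ≠ 0) {a : ℕ}
    (ha : a ∈ rightDegrees f) :
    ∃ g h : F[X], f = g.comp h ∧ h.Monic ∧ h.eval 0 = 0 ∧ h.natDegree = a := by
  have h0 := ne_zero_of_mem_rightDegrees hn ha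
  obtain ⟨g, h, hf, rfl⟩ := ha
  exact exists_monic_original_right hf h0

theorem natDegree_ne_zero_of_cast {f : F[X]} (hn : (f.natDegree : F) ≠ 0) : f.natDegree ≠ 0 :=
  fun h => hn (by rw [h, Nat.cast_zero])

theorem lcm_mem_rightDegrees {f : F[X]} (hf : f.Monic) (hn : (f.natDegree : F) ≠ 0) {a b : ℕ}
    (ha : a ∈ rightDegrees f) (hb : b ∈ rightDegrees f) : Nat.lcm a b ∈ rightDegrees f := by
  obtain ⟨g₁, h₁, hf₁, hm₁, -, rfl⟩ := exists_monic_right_of_mem (natDegree_ne_zero_of_cast hn) ha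
  obtain ⟨g₂, h₂, hf₂, hm₂, -, rfl⟩ := exists_monic_right_of_mem (natDegree_ne_zero_of_cast hn) hb
  obtain ⟨w, g, u₁, u₂, -, hwd, hg, -, -⟩ := exists_right_component_lcm hf hn hm₁ hm₂ hf₁ hf₂
  exact ⟨g, w, hg, hwd⟩

theorem gcd_mem_rightDegrees {f : F[X]} (hf : f.Monic) (hn : (f.natDegree : F) ≠ 0) {a b : ℕ}
    (ha : a ∈ rightDegrees f) (hb : b ∈ rightDegrees f) : Nat.gcd a b ∈ rightDegrees f := by
  have hn0 := natDegree_ne_zero_of_cast hn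
  have ha0 := ne_zero_of_mem_rightDegrees hn0 ha
  have hb0 := ne_zero_of_mem_rightDegrees hn0 hb
  obtain ⟨g₁, h₁, hf₁, hm₁, -, rfl⟩ := exists_monic_right_of_mem hn0 ha
  obtain ⟨g₂, h₂, hf₂, hm₂, -, rfl⟩ := exists_monic_right_of_mem hn0 hb
  obtain ⟨w, g, u₁, u₂, hwm, hwd, hg, hw₁, hw₂⟩ :=
    exists_right_component_lcm hf hn hm₁ hm₂ hf₁ hf₂
  obtain ⟨v, h, hv, hh⟩ := exists_right_component_gcd hwm hm₁ hm₂ ha0 hb0 hw₁ hw₂ hwd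
  exact ⟨g₁.comp v, h, by rw [comp_assoc, ← hv, hf₁], hh⟩

/-- In the tame case, right components of `f` are nested as soon as their degrees divide: a right
component of degree `lcm b (deg h) = deg h` is a linear left multiple of `h`. -/
theorem mem_rightDegrees_of_dvd {f g h : F[X]} (hf : f.Monic) (hn : (f.natDegree : F) ≠ 0)
    (hm : h.Monic) (hgh : f = g.comp h) {b : ℕ} (hb : b ∈ rightDegrees f)
    (hdvd : b ∣ h.natDegree) : b ∈ rightDegrees h := by
  have hn0 := natDegree_ne_zero_of_cast hn
  have hh0 : h.natDegree ≠ 0 := ne_zero_of_mem_rightDegrees hn0 ⟨g, h, hgh, rfl⟩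
  obtain ⟨g₂, h₂, hf₂, hm₂, -, rfl⟩ := exists_monic_right_of_mem hn0 hb
  obtain ⟨w, -, u₁, u₂, hwm, hwd, -, hw₁, hw₂⟩ :=
    exists_right_component_lcm hf hn hm hm₂ hgh hf₂
  rw [Nat.lcm_eq_left hdvd, hw₁, natDegree_comp] at hwd
  have hu1 : u₁.natDegree = 1 :=
    Nat.eq_of_mul_eq_mul_right (Nat.pos_of_ne_zero hh0) (by rw [hwd, one_mul])
  obtain ⟨r, hr, s, hu⟩ := natDegree_eq_one.1 hu1
  refine ⟨(C r⁻¹ * (X - C s)).comp u₂, h₂, ?_, rfl⟩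
  rw [comp_assoc, ← hw₂, hw₁, ← hu]
  simp only [mul_comp, sub_comp, add_comp, C_comp, X_comp, add_sub_cancel_right]
  rw [← mul_assoc, ← C_mul, inv_mul_cancel₀ hr, C_1, one_mul]

theorem compList_append (l₁ l₂ : List F[X]) :
    compList (l₁ ++ l₂) = (compList l₁).comp (compList l₂) := by
  induction l₁ with
  | nil => simp [compList]
  | cons g l ih =>
    change g.comp (compList (l ++ l₂)) = (g.comp (compList l)).comp (compList l₂)
    rw [ih, comp_assoc]

theorem natDegree_compList (l : List F[X]) :
    (compList l).natDegree = (l.map natDegree).prod := by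
  induction l with
  | nil => simp [compList]
  | cons g l ih =>
    change (g.comp (compList l)).natDegree = _
    rw [natDegree_comp, ih, List.map_cons, List.prod_cons]

theorem HasDegreeSequence.prod_mem {f : F[X]} {d s : List ℕ} (h : HasDegreeSequence f d)
    (hs : s <:+ d) : s.prod ∈ rightDegrees f := by
  obtain ⟨gs, rfl, rfl⟩ := h
  obtain ⟨t, ht⟩ := hs
  obtain ⟨l₁, l₂, rfl, -, rfl⟩ := List.map_eq_append_iff.1 ht.symm
  exact ⟨compList l₁, compList l₂, compList_append _ _, natDegree_compList _⟩

/-- A tame polynomial has a decomposition with a given degree sequence as soon as it has right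
components of all the degrees this requires. -/
theorem hasDegreeSequence_of_prod_mem {f : F[X]} (hf : f.Monic) (hf0 : f.eval 0 = 0)
    (hn : (f.natDegree : F) ≠ 0) {d : List ℕ} (hd : d.prod = f.natDegree)
    (h : ∀ s, s <:+ d → s.prod ∈ rightDegrees f) : HasDegreeSequence f d := by
  induction d generalizing f with
  | nil =>
    refine ⟨[], rfl, ?_⟩
    have hX := hf.eq_X_add_C (by simpa using hd.symm)
    rw [hX] at hf0
    simp only [eval_add, eval_X, eval_C, zero_add] at hf0
    rw [hX, hf0, C_0, add_zero]
    rfl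
  | cons a d ih =>
    obtain ⟨g, k, rfl, hm, hk0, hk⟩ := exists_monic_right_of_mem (natDegree_ne_zero_of_cast hn)
      (h d (List.suffix_cons a d))
    have hn0 := natDegree_ne_zero_of_cast hn
    rw [natDegree_comp] at hn0
    obtain ⟨gs, hgs, hkgs⟩ := ih hm hk0
      (fun h0 => hn (by rw [natDegree_comp, Nat.cast_mul, h0, mul_zero])) hk.symm
      (fun s hs => mem_rightDegrees_of_dvd hf hn hm rfl (h s (hs.trans (List.suffix_cons a d)))
        (by rw [hk]; exact hs.sublist.prod_dvd_prod))
    refine ⟨g :: gs, ?_, ?_⟩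
    · rw [List.map_cons, hgs]
      congr 1
      rw [List.prod_cons, natDegree_comp, ← hk] at hd
      exact (Nat.eq_of_mul_eq_mul_right (Nat.pos_of_ne_zero (right_ne_zero_of_mul hn0)) hd).symm
    · rw [hkgs]; rfl

end Components

/-! ### Vertices as positions -/

theorem count_take_eq_card (d : List ℕ) (i a : ℕ) :
    (d.take i).count a = ((Finset.range i).filter fun k => d[k]? = some a).card := by
  induction i with
  | zero => simp
  | succ i ih =>
    rw [List.take_add_one, List.count_append, ih, Finset.range_add_one, Finset.filter_insert]
    rcases h : d[i]? with _ | b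
    · simp
    · by_cases hb : b = a
      · subst hb
        simp
      · simp [hb]

theorem count_take_eq_card_fin (d : List ℕ) (i : Fin d.length) (a : ℕ) :
    (d.take i).count a = (Finset.univ.filter fun k => k < i ∧ d.get k = a).card := by
  rw [count_take_eq_card]
  symm
  refine Finset.card_bij (fun k _ => (k : ℕ)) ?_ (fun _ _ _ _ h => Fin.ext h) ?_
  · intro k hk
    simp only [Finset.mem_filter, Finset.mem_univ, true_and, Finset.mem_range] at hk ⊢
    exact ⟨hk.1, by rw [List.getElem?_eq_getElem k.2, ← hk.2]; rfl⟩
  · intro k hk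
    simp only [Finset.mem_filter, Finset.mem_range] at hk
    obtain ⟨hlt, hka⟩ := List.getElem?_eq_some_iff.1 hk.2
    exact ⟨⟨k, hlt⟩, by simpa using ⟨hk.1, hka⟩, rfl⟩

section Vertices

variable {B : Multiset ℕ}

theorem IsAt.eq_vertex {d : List ℕ} {i : ℕ} {v w : Vertex B} (hv : IsAt d i v)
    (hw : IsAt d i w) : v = w := by
  obtain ⟨a, k⟩ := v
  obtain ⟨b, m⟩ := w
  obtain ⟨h1, h2⟩ := hv
  obtain ⟨h3, h4⟩ := hw
  obtain rfl : a = b := Option.some.inj (h1.symm.trans h3)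
  obtain rfl : k = m := Fin.ext (h2.symm.trans h4)
  rfl

theorem IsAt.not_lt {d : List ℕ} {i j : ℕ} {v : Vertex B} (hi : IsAt d i v) (hj : IsAt d j v) :
    ¬ i < j := by
  intro hij
  have h1 : (d.take (i + 1)).count v.1 = (v.2 : ℕ) + 1 := by
    rw [List.take_add_one, List.count_append, hi.2, hi.1]
    simp
  have h2 : (d.take (i + 1)).count v.1 ≤ (d.take j).count v.1 :=
    (List.take_sublist_take_left hij).count_le _
  rw [h1, hj.2] at h2
  omega

theorem IsAt.eq_index {d : List ℕ} {i j : ℕ} {v : Vertex B} (hi : IsAt d i v)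
    (hj : IsAt d j v) : i = j :=
  le_antisymm (le_of_not_gt (hj.not_lt hi)) (le_of_not_gt (hi.not_lt hj))

theorem exists_isAt_of_lt {d : List ℕ} (hd : B = d) (i : Fin d.length) :
    ∃ v : Vertex B, IsAt d i v := by
  have hlt : (d.take i).count d[i] < B.count d[i] := by
    have h1 : (d.take (i + 1)).count d[i] = (d.take i).count d[i] + 1 := by
      rw [List.take_add_one, List.count_append, List.getElem?_eq_getElem i.2]
      simp
    have h2 := (List.take_sublist (i + 1) d).count_le d[i]
    rw [hd, Multiset.coe_count]
    omega
  exact ⟨⟨d[i], ⟨_, hlt⟩⟩, List.getElem?_eq_getElem i.2, rfl⟩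

/-- An arrangement `d` of the multiset `B` is the same as an enumeration of its vertices. -/
theorem exists_lift {d : List ℕ} (hd : B = d) :
    ∃ l : List (Vertex B), l.Nodup ∧ (∀ v, v ∈ l) ∧ l.map (fun v => v.1) = d ∧
      ∀ i v, l[i]? = some v ↔ IsAt d i v := by
  choose φ hφ using exists_isAt_of_lt hd
  have hinj : Function.Injective φ := fun i j hij =>
    Fin.ext ((hφ i).eq_index (by rw [hij]; exact hφ j))
  have hsurj : Function.Surjective φ := by
    refine ((Fintype.bijective_iff_injective_and_card φ).2 ⟨hinj, ?_⟩).2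
    rw [Fintype.card_fin, Multiset.card_coe, hd, Multiset.coe_card]
  refine ⟨List.ofFn φ, List.nodup_ofFn.2 hinj, fun v => ?_, ?_, fun i v => ⟨fun h => ?_,
    fun h => ?_⟩⟩
  · obtain ⟨i, rfl⟩ := hsurj v
    exact List.mem_ofFn.2 ⟨i, rfl⟩
  · rw [List.map_ofFn]
    conv_rhs => rw [← List.ofFn_get d]
    congr 1
    funext i
    have := (hφ i).1
    rw [List.getElem?_eq_getElem i.2] at this
    exact (Option.some.inj this).symm
  · obtain ⟨hlt, h⟩ := List.getElem?_eq_some_iff.1 h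
    rw [List.length_ofFn] at hlt
    rw [List.getElem_ofFn] at h
    rw [← h]
    exact hφ ⟨i, hlt⟩
  · obtain ⟨hlt, -⟩ := List.getElem?_eq_some_iff.1 h.1
    rw [List.getElem?_eq_some_iff]
    refine ⟨by rwa [List.length_ofFn], ?_⟩
    rw [List.getElem_ofFn]
    exact (hφ ⟨i, hlt⟩).eq_vertex h

theorem precedes_or_precedes {d : List ℕ} (hd : B = d) {u v : Vertex B} (huv : u ≠ v) :
    Precedes d u v ∨ Precedes d v u := by
  obtain ⟨l, -, hmem, -, hl⟩ := exists_lift hd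
  obtain ⟨i, hi⟩ := List.mem_iff_getElem?.1 (hmem u)
  obtain ⟨j, hj⟩ := List.mem_iff_getElem?.1 (hmem v)
  rcases lt_trichotomy i j with h | rfl | h
  · exact Or.inl ⟨i, j, h, (hl _ _).1 hi, (hl _ _).1 hj⟩
  · exact absurd (Option.some.inj (hi.symm.trans hj)) huv
  · exact Or.inr ⟨j, i, h, (hl _ _).1 hj, (hl _ _).1 hi⟩

/-- Associated factorizations order every two vertices with a common factor in the same way. -/
theorem AreAssociated.precedes {d e : List ℕ} (h : AreAssociated d e) {u v : Vertex B}
    (huv : Precedes d u v) (hg : ¬ Nat.Coprime u.1 v.1) (hu : 0 < u.1) : Precedes e u v := by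
  obtain ⟨σ, h1, h2, h3⟩ := h
  -- `σ` matches the `k`-th occurrences, since it preserves the order of equal entries
  have hmove : ∀ {w : Vertex B} (i : Fin d.length), IsAt d i w → IsAt e (σ i) w := by
    rintro w i ⟨hi1, hi2⟩
    have hdi : d.get i = w.1 := by
      rw [List.getElem?_eq_getElem i.2] at hi1
      exact Option.some.inj hi1
    refine ⟨?_, ?_⟩
    · rw [List.getElem?_eq_getElem (σ i).2, ← hdi, h1 i]; rfl
    · rw [← hi2, count_take_eq_card_fin, count_take_eq_card_fin]
      symm
      refine Finset.card_equiv σ fun k => ?_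
      simp only [Finset.mem_filter, Finset.mem_univ, true_and, ← h1 k]
      refine and_congr_left fun hk => ⟨fun hki => h2 k i hki (hk.trans hdi.symm), fun hki => ?_⟩
      by_contra hnot
      rcases (not_lt.1 hnot).eq_or_lt with rfl | hlt
      · exact lt_irrefl _ hki
      · exact lt_asymm hki (h2 i k hlt (hdi.trans hk.symm))
  obtain ⟨i, j, hij, hi, hj⟩ := huv
  obtain ⟨hil, hi'⟩ := List.getElem?_eq_some_iff.1 hi.1
  obtain ⟨hjl, hj'⟩ := List.getElem?_eq_some_iff.1 hj.1
  refine ⟨σ ⟨i, hil⟩, σ ⟨j, hjl⟩, h3 _ _ hij ?_, hmove ⟨i, hil⟩ hi, hmove ⟨j, hjl⟩ hj⟩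
  rw [List.get_eq_getElem, List.get_eq_getElem, hi', hj']
  have h0 : 0 < Nat.gcd u.1 v.1 := Nat.gcd_pos_of_pos_left _ hu
  have hne : Nat.gcd u.1 v.1 ≠ 1 := hg
  omega

end Vertices

/-! ### Up-closed sets of weighted elements -/

section UpClosed

variable {V : Type*} [DecidableEq V] (wt : V → ℕ) (P : V → V → Prop)

/-- `S` contains, with each `u`, every `v` that is related to `u` by `P` and has a weight not
coprime to that of `u`. -/
def IsUpClosed (S : Finset V) : Prop :=
  ∀ u ∈ S, ∀ v, P u v → ¬ Nat.Coprime (wt u) (wt v) → v ∈ S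

variable {wt P}

theorem IsUpClosed.inter {S T : Finset V} (hS : IsUpClosed wt P S) (hT : IsUpClosed wt P T) :
    IsUpClosed wt P (S ∩ T) := fun u hu v huv hc => by
  rw [Finset.mem_inter] at hu ⊢
  exact ⟨hS u hu.1 v huv hc, hT u hu.2 v huv hc⟩

theorem IsUpClosed.union {S T : Finset V} (hS : IsUpClosed wt P S) (hT : IsUpClosed wt P T) :
    IsUpClosed wt P (S ∪ T) := fun u hu v huv hc => by
  rw [Finset.mem_union] at hu ⊢
  exact hu.imp (fun h => hS u h v huv hc) (fun h => hT u h v huv hc)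

theorem IsUpClosed.coprime_sdiff (htot : ∀ u v, u ≠ v → P u v ∨ P v u) {S T : Finset V}
    (hS : IsUpClosed wt P S) (hT : IsUpClosed wt P T) :
    Nat.Coprime (∏ v ∈ S \ T, wt v) (∏ v ∈ T \ S, wt v) := by
  refine Nat.Coprime.prod_left fun u hu => Nat.Coprime.prod_right fun v hv => ?_
  rw [Finset.mem_sdiff] at hu hv
  by_contra hc
  rcases htot u v (by rintro rfl; exact hu.2 hv.1) with h | h
  · exact hv.2 (hS u hu.1 v h hc)
  · exact hu.2 (hT v hv.1 u h (fun h' => hc h'.symm))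

theorem IsUpClosed.prod_inter (htot : ∀ u v, u ≠ v → P u v ∨ P v u) {S T : Finset V}
    (hS : IsUpClosed wt P S) (hT : IsUpClosed wt P T) :
    ∏ v ∈ S ∩ T, wt v = Nat.gcd (∏ v ∈ S, wt v) (∏ v ∈ T, wt v) := by
  have h := hS.coprime_sdiff htot hT
  rw [← Finset.prod_inter_mul_prod_sdiff S T, ← Finset.prod_inter_mul_prod_sdiff T S,
    Finset.inter_comm T S, Nat.gcd_mul_left, Nat.Coprime.gcd_eq_one h, mul_one]

theorem IsUpClosed.prod_union (htot : ∀ u v, u ≠ v → P u v ∨ P v u) {S T : Finset V}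
    (hS : IsUpClosed wt P S) (hT : IsUpClosed wt P T) :
    ∏ v ∈ S ∪ T, wt v = Nat.lcm (∏ v ∈ S, wt v) (∏ v ∈ T, wt v) := by
  have h := hS.coprime_sdiff htot hT
  rw [← Finset.prod_inter_mul_prod_sdiff S T, ← Finset.prod_inter_mul_prod_sdiff T S,
    Finset.inter_comm T S, Nat.lcm_mul_left, h.lcm_eq_mul, ← mul_assoc,
    Finset.prod_inter_mul_prod_sdiff]
  rw [← Finset.prod_union Finset.disjoint_sdiff, Finset.union_sdiff_self_eq_union]

/-- If a set `R` of natural numbers is closed under `gcd` and `lcm`, then the up-closed sets with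
product in `R` form a lattice of sets, and this contains every set that can be separated by its
members: `S = ⋃_{v ∈ S} ⋂_{u ∉ S} T u v` if `T u v` contains `v` and not `u`. -/
theorem prod_mem_of_separated [Fintype V] (htot : ∀ u v, u ≠ v → P u v ∨ P v u) {R : Set ℕ}
    (hgcd : ∀ a ∈ R, ∀ b ∈ R, Nat.gcd a b ∈ R) (hlcm : ∀ a ∈ R, ∀ b ∈ R, Nat.lcm a b ∈ R)
    (hone : 1 ∈ R) (huniv : ∏ v, wt v ∈ R) {S : Finset V}
    (hsep : ∀ u ∉ S, ∀ v ∈ S, ∃ T : Finset V, IsUpClosed wt P T ∧ ∏ v ∈ T, wt v ∈ R ∧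
      v ∈ T ∧ u ∉ T) : ∏ v ∈ S, wt v ∈ R := by
  let good : Finset V → Prop := fun T => IsUpClosed wt P T ∧ ∏ v ∈ T, wt v ∈ R
  choose! T hTc hTR hvT huT using hsep
  have hinf : ∀ v ∈ S, good (Sᶜ.inf fun u => T u v) := fun v hv =>
    Finset.inf_induction ⟨fun _ _ _ _ _ => Finset.mem_univ _, huniv⟩
      (fun A hA C hC => ⟨hA.1.inter hC.1, by
        rw [Finset.inf_eq_inter, hA.1.prod_inter htot hC.1]; exact hgcd _ hA.2 _ hC.2⟩)
      (fun u hu => ⟨hTc u (Finset.mem_compl.1 hu) v hv, hTR u (Finset.mem_compl.1 hu) v hv⟩)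
  have hsup : good (S.sup fun v => Sᶜ.inf fun u => T u v) :=
    Finset.sup_induction ⟨fun _ h => absurd h (Finset.notMem_empty _), by simpa using hone⟩
      (fun A hA C hC => ⟨hA.1.union hC.1, by
        rw [Finset.sup_eq_union, hA.1.prod_union htot hC.1]; exact hlcm _ hA.2 _ hC.2⟩) hinf
  have hSeq : (S.sup fun v => Sᶜ.inf fun u => T u v) = S := by
    ext x
    rw [Finset.mem_sup]
    constructor
    · rintro ⟨v, hv, hx⟩
      by_contra hxS
      rw [Finset.mem_inf] at hx
      exact huT x hxS v hv (hx x (Finset.mem_compl.2 hxS))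
    · intro hx
      refine ⟨x, hx, ?_⟩
      rw [Finset.mem_inf]
      exact fun u hu => hvT u (Finset.mem_compl.1 hu) x hx
  rw [← hSeq]
  exact hsup.2

end UpClosed

/-! ### Transitive Hamiltonian paths -/

section RelationGraph

variable {n : ℕ} {D : Finset (List ℕ)}

/-- Each element of `D` is itself the sequence of a transitive Hamiltonian path. -/
theorem exists_transitive_path (hD : IsNormalized n D) {d : List ℕ} (hd : d ∈ D) :
    ∃ e : List (Vertex (basis D)), IsHamiltonianPath (relationGraph D) e ∧
      IsTransitivePath (relationGraph D) e ∧ e.map (fun v => v.1) = d := by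
  obtain ⟨l, hnd, hmem, hmap, hl⟩ := exists_lift (basis_eq hD hd)
  have hpw : l.Pairwise (fun v w => (relationGraph D).Adj w v) := by
    rw [List.pairwise_iff_getElem]
    intro i j hi hj hij
    exact ⟨d, hd, i, j, hij, (hl _ _).1 (List.getElem?_eq_getElem hi),
      (hl _ _).1 (List.getElem?_eq_getElem hj)⟩
  exact ⟨l, ⟨hpw.isChain, hnd, hmem⟩, hpw, hmap⟩

theorem two_le_vertex (hne : D.Nonempty) (hD : IsNormalized n D) (v : Vertex (basis D)) :
    2 ≤ v.1 := by
  obtain ⟨d, hd⟩ := hne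
  refine (hD.1 d hd).1 _ ?_
  have h : v.1 ∈ basis D := Multiset.coe_mem
  exact Multiset.mem_coe.1 (Multiset.mem_of_le (basis_eq hD hd).le h)

/-- A vertex `u` that precedes `v` in some `d ∈ D` is separated from `v` by the suffix of `d` that
starts at `v`. This suffix is up-closed: the order of vertices with a common factor is the same in
all elements of `D`. -/
theorem exists_suffix_separating (hne : D.Nonempty) (hD : IsNormalized n D) {d : List ℕ}
    (hd : d ∈ D) {u v : Vertex (basis D)} (huv : Precedes d u v) :
    ∃ T : Finset (Vertex (basis D)),
      IsUpClosed (fun v : Vertex (basis D) => v.1) (fun u v => ∃ d ∈ D, Precedes d u v) T ∧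
      (∃ s, s <:+ d ∧ ∏ v ∈ T, v.1 = s.prod) ∧ v ∈ T ∧ u ∉ T := by
  classical
  obtain ⟨l, hnd, -, hmap, hl⟩ := exists_lift (basis_eq hD hd)
  obtain ⟨i, j, hij, hi, hj⟩ := huv
  have hT : ∀ w, w ∈ (l.drop j).toFinset ↔ ∃ k, j ≤ k ∧ IsAt d k w := by
    intro w
    rw [List.mem_toFinset, List.mem_iff_getElem?]
    constructor
    · rintro ⟨k, hk⟩
      rw [List.getElem?_drop] at hk
      exact ⟨j + k, by omega, (hl _ _).1 hk⟩
    · rintro ⟨k, hjk, hk⟩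
      refine ⟨k - j, ?_⟩
      rw [List.getElem?_drop, Nat.add_sub_cancel' hjk]
      exact (hl _ _).2 hk
  refine ⟨(l.drop j).toFinset, ?_, ⟨d.drop j, List.drop_suffix _ _, ?_⟩, (hT v).2 ⟨j, le_rfl, hj⟩,
    fun h => ?_⟩
  · rintro x hx y ⟨d', hd', hxy⟩ hc
    obtain ⟨k, hk, hkx⟩ := (hT x).1 hx
    obtain ⟨a, b, hab, ha, hb⟩ := (hD.2 d' hd' d hd).precedes hxy hc
      (Nat.zero_lt_two.trans_le (two_le_vertex hne hD x))
    exact (hT y).2 ⟨b, by have := ha.eq_index hkx; omega, hb⟩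
  · rw [List.prod_toFinset _ (hnd.sublist (List.drop_sublist _ _)), List.map_drop, hmap]
  · obtain ⟨k, hk, hku⟩ := (hT u).1 h
    have := hku.eq_index hi
    omega

end RelationGraph

end TameDecomp

theorem proposition3p13 (F : Type*) [Field F] (p : ℕ) [CharP F p] (n : ℕ) (hn : 0 < n)
    (hp : ¬ p ∣ n) (D : Finset (List ℕ)) (hne : D.Nonempty)
    (hD : TameDecomp.IsNormalized n D) :
    TameDecomp.collisions F n D =
      TameDecomp.graphCollisions F (TameDecomp.relationGraph D) := by
  classical
  open TameDecomp in
  have hBn : (basis D).prod = n := by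
    obtain ⟨d, hd⟩ := hne
    rw [basis_eq hD hd, Multiset.prod_coe]
    exact (hD.1 d hd).2
  ext f
  constructor
  · rintro ⟨hf, hfD⟩
    refine ⟨by rwa [hBn], fun e he htr => ?_⟩
    obtain ⟨hfm, hf0, hfn⟩ := hf
    have hnF : (f.natDegree : F) ≠ 0 := by
      rw [hfn]
      exact fun h => hp ((CharP.cast_eq_zero_iff F p n).1 h)
    have hprod : ∏ v : Vertex (basis D), v.1 = f.natDegree := by
      rw [hfn, ← hBn]
      exact (Multiset.prod_eq_prod_coe (basis D)).symm
    have hsub : ∀ {l : List (Vertex (basis D))}, l.Nodup →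
        (l.map fun v => v.1).prod = ∏ v ∈ l.toFinset, v.1 := fun hl =>
      (List.prod_toFinset _ hl).symm
    refine hasDegreeSequence_of_prod_mem hfm hf0 hnF ?_ ?_
    · rw [hsub he.2.1, ← hprod]
      congr 1
      ext v
      simpa using he.2.2 v
    · rintro s ⟨t, hs⟩
      obtain ⟨e₁, e₂, rfl, -, rfl⟩ := List.map_eq_append_iff.1 hs.symm
      have hnd := List.nodup_append.1 he.2.1
      rw [hsub hnd.2.1]
      refine prod_mem_of_separated (wt := fun v : Vertex (basis D) => v.1)
        (P := fun u v => ∃ d ∈ D, Precedes d u v) ?_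
        (fun a ha b hb => gcd_mem_rightDegrees hfm hnF ha hb)
        (fun a ha b hb => lcm_mem_rightDegrees hfm hnF ha hb)
        ⟨f, Polynomial.X, by simp, by simp⟩ ⟨Polynomial.X, f, by simp, hprod.symm⟩ ?_
      · obtain ⟨d, hd⟩ := hne
        exact fun u v huv => (precedes_or_precedes (basis_eq hD hd) huv).imp
          (fun h => ⟨d, hd, h⟩) (fun h => ⟨d, hd, h⟩)
      · intro u hu v hv
        rw [List.mem_toFinset] at hu hv
        have hu₁ : u ∈ e₁ := (List.mem_append.1 (he.2.2 u)).resolve_right hu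
        obtain ⟨d, hd, huv⟩ := (List.pairwise_append.1 htr).2.2 u hu₁ v hv
        obtain ⟨T, hT, ⟨s, hs, hsT⟩, hvT, huT⟩ := exists_suffix_separating hne hD hd huv
        exact ⟨T, hT, by rw [hsT]; exact (hfD d hd).prod_mem hs, hvT, huT⟩
  · rintro ⟨hf, hfG⟩
    rw [hBn] at hf
    refine ⟨hf, fun d hd => ?_⟩
    obtain ⟨e, he, htr, rfl⟩ := exists_transitive_path hD hd
    exact hfG e he htr
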